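/- Let $a\in[0,\infty)$ with $a\neq 1$ and let $\tau$ be a positive integer. There exist an infinite-dimensional separable complex Banach space $X$, a sequence $(\lambda_n)_{n\ge 1}$ of non-zero complex numbers and a bounded linear operator $T:X\to X$ such that $$\lim_{n\to\infty}\frac{|\lambda_n|}{|\lambda_{n+\tau}|}=a,$$ the sequence of operators $(\lambda_nT^n)_{n\ge 1}$ is frequently universal, and $T$ is not recurrent. Here $(T_n)_{n\ge 1}$ is called frequently universal if there is a vector $x\in X$ such that for every non-empty open set $U\subset X$ the set $B=\{n\ge 1: T_nx\in U\}$ has positive lower density, i.e. $\liminf_{N\to\infty}\frac{|\{n\in B:\, n\le N\}|}{N}>0$; and $T$ is called recurrent if for every non-empty open set $U\subset X$ there is a positive integer $k$ with $U\cap T^{-k}U\neq\emptyset$. -/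

import Mathlib

/-- The lower density `liminf_{N → ∞} |{n ∈ B : 1 ≤ n ≤ N}| / N` of (the set of positive integers in)
`B`. The quotients lie in `[0, 1]`, so the real-valued `liminf` is the usual one. -/
noncomputable def lowerDensity (B : Set ℕ) : ℝ :=
  Filter.liminf (fun N : ℕ => (({n : ℕ | n ∈ B ∧ 1 ≤ n ∧ n ≤ N}.ncard : ℕ) : ℝ) / (N : ℝ))
    Filter.atTop

/-- The sequence of bounded operators `S 1, S 2, …` on `X` is frequently universal (the value `S 0`
plays no role). -/
def FrequentlyUniversal {X : Type*} [NormedAddCommGroup X] [NormedSpace ℂ X]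
    (S : ℕ → X →L[ℂ] X) : Prop :=
  ∃ x : X, ∀ U : Set X, IsOpen U → U.Nonempty → 0 < lowerDensity {n : ℕ | S n x ∈ U}

/-- The bounded operator `T` is recurrent: every non-empty open `U` meets `T⁻ᵏ U` for some
positive integer `k`. -/
def IsRecurrentOperator {X : Type*} [NormedAddCommGroup X] [NormedSpace ℂ X]
    (T : X →L[ℂ] X) : Prop :=
  ∀ U : Set X, IsOpen U → U.Nonempty → ∃ k : ℕ, 1 ≤ k ∧ (U ∩ (T ^ k) ⁻¹' U).Nonempty

/-!
The operator is a weighted backward shift `T` on `ℓ¹`. No power of `T` brings a vector near the unit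
vector `e₀` back near `e₀`, as a single coordinate shows, whereas the multipliers `lam n` make the
operators `lam n • T ^ n` frequently universal.

Frequent universality comes from a criterion (`frequentlyUniversal_of_dense_majorizedVectors`).
Suppose that a dense set of vectors `y` have a backward orbit `z` (`z 0 = y`, `T (z (n + 1)) = z n`)
for which the norms of `(lam k / lam (k + n)) • z n` and `(lam (k + n) / lam k) • T ^ n y` are
bounded, for large `n` and uniformly in `k`, by a summable sequence. If `x` is the sum of
`(lam n)⁻¹ • z n` over the times `n` in a set `A`, then at a time `k ∈ A` the operator
`lam k • T ^ k` sends the `k`-th term to `y`, and what the other terms become is bounded by tails of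
the majorant, which are small when the times in `A` are far apart. The universal vector is a sum of
such blocks over countably many orbits, placed on sets of positive lower density whose mutual
distances grow with the index (`exists_separated_positions`). These sets consist of the terms with
index of a given 2-adic valuation in a sequence of linear growth whose gaps are controlled by the
valuations.

For `a > 0` let `lam n = c ^ n` with `c ^ τ = a⁻¹`, and let `T` be the bilateral shift with weight
`u` on the negative side and `v` on the positive side, where `c * u < 1 < c * v` makes both orbits of
each unit vector decay geometrically. As `c ≠ 1`, one of `u`, `v` can be taken to be `1`, and this
rules out recurrence: either `e₀` is moved away without loss of norm, or nothing arriving at the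
coordinate `0` is amplified. For `a = 0` let `lam n = n! * 2 ^ n` and let `T` be the unilateral shift
with weights `1 / (i + 1)`; the unit vectors are then annihilated by a power of `T`, and the
majorants of their backward orbits are `(n + j).choose j / 2 ^ n`.
-/

/-! ### Positive lower density -/

/-- A set that contains an injective sequence of at most linear growth has positive lower
density. -/
theorem lowerDensity_pos_of_linear_growth {B : Set ℕ} (f : ℕ → ℕ) (hf : Function.Injective f)
    (hB : ∀ i, f i ∈ B) (hpos : ∀ i, 1 ≤ f i) (D : ℕ) (hD : ∀ i, f i ≤ D * (i + 1)) :
    0 < lowerDensity B := by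
  have hD0 : 0 < D := by
    have h1 := hpos 0
    have h2 := hD 0
    rcases Nat.eq_zero_or_pos D with h | h
    · simp [h] at h2; omega
    · exact h
  have hfin : ∀ N : ℕ, {n : ℕ | n ∈ B ∧ 1 ≤ n ∧ n ≤ N}.Finite := fun N =>
    (Set.finite_Iic N).subset fun n hn => hn.2.2
  have hcount : ∀ N : ℕ, N / D ≤ {n : ℕ | n ∈ B ∧ 1 ≤ n ∧ n ≤ N}.ncard := by
    intro N
    have hsub : f '' (Finset.range (N / D) : Set ℕ) ⊆ {n : ℕ | n ∈ B ∧ 1 ≤ n ∧ n ≤ N} := by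
      rintro _ ⟨i, hi, rfl⟩
      have hi' : i + 1 ≤ N / D := by simpa using hi
      refine ⟨hB i, hpos i, (hD i).trans ?_⟩
      exact (Nat.mul_le_mul_left D hi').trans (Nat.mul_div_le N D)
    have h := Set.ncard_le_ncard hsub (hfin N)
    rwa [Set.ncard_image_of_injective _ hf, Set.ncard_coe_finset, Finset.card_range] at h
  have hDr : (0 : ℝ) < D := by exact_mod_cast hD0
  have hlow : (1 / (2 * D) : ℝ) ≤ lowerDensity B := by
    refine Filter.le_liminf_of_le ?_ ?_
    · refine Filter.IsCoboundedUnder.of_frequently_le (a := 1) (Filter.Frequently.of_forall ?_)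
      intro N
      refine div_le_one_of_le₀ ?_ (Nat.cast_nonneg N)
      have h := Set.ncard_le_ncard (t := (Finset.Icc 1 N : Set ℕ))
        (s := {n : ℕ | n ∈ B ∧ 1 ≤ n ∧ n ≤ N}) (fun n hn => by simpa using hn.2)
        (Finset.finite_toSet _)
      rw [Set.ncard_coe_finset, Nat.card_Icc] at h
      exact_mod_cast h
    · filter_upwards [Filter.eventually_ge_atTop (2 * D)] with N hN
      have hN0 : (0 : ℝ) < N := by exact_mod_cast (by omega : 0 < N)
      have h1 : (N : ℝ) < D * ((N / D : ℕ) + 1) := by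
        exact_mod_cast Nat.lt_mul_div_succ N hD0
      have h2 : ((N / D : ℕ) : ℝ) ≤ ({n : ℕ | n ∈ B ∧ 1 ≤ n ∧ n ≤ N}.ncard : ℕ) := by
        exact_mod_cast hcount N
      have h3 : (2 * D : ℝ) ≤ N := by exact_mod_cast hN
      rw [div_le_div_iff₀ (by positivity) hN0]
      nlinarith
  exact lt_of_lt_of_le (by positivity) hlow

/-! ### Separated families of positions -/

/-- An increasing sequence of linear growth whose gap between `n` and `n + 1` is
`v₂(n) + v₂(n + 1) + 1`, where `v₂` is the 2-adic valuation; the valuations are summed by means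
of `v₂(n!)`. -/
def dyadicPosition (n : ℕ) : ℕ :=
  n + padicValNat 2 n.factorial + padicValNat 2 (n - 1).factorial

theorem dyadicPosition_succ {n : ℕ} (hn : 1 ≤ n) :
    dyadicPosition (n + 1) = dyadicPosition n + padicValNat 2 n + padicValNat 2 (n + 1) + 1 := by
  obtain ⟨m, rfl⟩ : ∃ m, n = m + 1 := ⟨n - 1, by omega⟩
  have h : ∀ k : ℕ, padicValNat 2 (k + 1).factorial
      = padicValNat 2 (k + 1) + padicValNat 2 k.factorial := fun k => by
    rw [Nat.factorial_succ, padicValNat.mul (by omega) (Nat.factorial_ne_zero k)]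
  simp only [dyadicPosition, Nat.add_sub_cancel]
  rw [h (m + 1), h m]
  omega

theorem le_dyadicPosition (n : ℕ) : n ≤ dyadicPosition n := by
  unfold dyadicPosition; omega

theorem dyadicPosition_le (n : ℕ) : dyadicPosition n ≤ 3 * n := by
  have h : ∀ k : ℕ, padicValNat 2 k.factorial ≤ k := fun k => by
    have := sub_one_mul_padicValNat_factorial (p := 2) k
    omega
  have h1 := h n
  have h2 := h (n - 1)
  unfold dyadicPosition
  omega

theorem dyadicPosition_mono {m n : ℕ} (hm : 1 ≤ m) (hmn : m ≤ n) :
    dyadicPosition m ≤ dyadicPosition n := by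
  induction n, hmn using Nat.le_induction with
  | base => exact le_rfl
  | succ k hk ih => rw [dyadicPosition_succ (hm.trans hk)]; omega

theorem dyadicPosition_gap {m n : ℕ} (hm : 1 ≤ m) (hmn : m < n) :
    dyadicPosition m + max (padicValNat 2 m) (padicValNat 2 n) < dyadicPosition n := by
  obtain ⟨k, rfl⟩ : ∃ k, n = k + 1 := ⟨n - 1, by omega⟩
  have h1 := dyadicPosition_mono hm (show m ≤ k by omega)
  have h2 := dyadicPosition_mono (m := m + 1) (by omega) (show m + 1 ≤ k + 1 by omega)
  have h3 := dyadicPosition_succ hm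
  have h4 := dyadicPosition_succ (n := k) (by omega)
  omega

theorem padicValNat_two_pow_mul_odd (v i : ℕ) : padicValNat 2 (2 ^ v * (2 * i + 1)) = v := by
  rw [padicValNat.mul (by positivity) (by omega), padicValNat.prime_pow,
    padicValNat.eq_zero_of_not_dvd (by omega), add_zero]

/-- There are sets of positive lower density, enumerated by `pos v`, such that distinct positions
`pos u i` and `pos v j` are more than `max u v` apart. -/
theorem exists_separated_positions : ∃ pos : ℕ → ℕ → ℕ,
    (∀ v i, 1 ≤ pos v i) ∧ (∀ v i, v ≤ pos v i) ∧ (∀ v, Function.Injective (pos v)) ∧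
    (∀ v, ∃ D, ∀ i, pos v i ≤ D * (i + 1)) ∧
    (∀ u v i j, (u = v ∧ i = j) ∨ pos u i + max u v < pos v j ∨
      pos v j + max u v < pos u i) := by
  have hone : ∀ v i : ℕ, 1 ≤ 2 ^ v * (2 * i + 1) := fun v i => Nat.succ_le_of_lt (by positivity)
  have hsep : ∀ u v i j : ℕ, (u = v ∧ i = j) ∨
      dyadicPosition (2 ^ u * (2 * i + 1)) + max u v < dyadicPosition (2 ^ v * (2 * j + 1)) ∨
      dyadicPosition (2 ^ v * (2 * j + 1)) + max u v < dyadicPosition (2 ^ u * (2 * i + 1)) := by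
    intro u v i j
    have hu := padicValNat_two_pow_mul_odd u i
    have hv := padicValNat_two_pow_mul_odd v j
    rcases lt_trichotomy (2 ^ u * (2 * i + 1)) (2 ^ v * (2 * j + 1)) with h | h | h
    · have := dyadicPosition_gap (hone u i) h
      rw [hu, hv] at this
      exact Or.inr (Or.inl this)
    · have huv : u = v := by rw [← hu, ← hv, h]
      subst huv
      have := Nat.eq_of_mul_eq_mul_left (by positivity) h
      exact Or.inl ⟨rfl, by omega⟩
    · have := dyadicPosition_gap (hone v j) h
      rw [hu, hv, max_comm] at this
      exact Or.inr (Or.inr this)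
  refine ⟨fun v i => dyadicPosition (2 ^ v * (2 * i + 1)), fun v i => ?_, fun v i => ?_,
    fun v i j hij => ?_, fun v => ⟨6 * 2 ^ v, fun i => ?_⟩, hsep⟩
  · exact (hone v i).trans (le_dyadicPosition _)
  · refine le_trans ?_ (le_dyadicPosition _)
    exact (Nat.lt_two_pow_self (n := v)).le.trans (Nat.le_mul_of_pos_right _ (by omega))
  · have h := hsep v v i j
    simp only at hij
    omega
  · refine (dyadicPosition_le _).trans ?_
    nlinarith [Nat.zero_le (2 ^ v)]

/-! ### Orbits with a summable majorant -/

section Criterion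

variable {X : Type*} [NormedAddCommGroup X] [NormedSpace ℂ X]

/-- The sequence `z` is a backward orbit of `z 0` under `T` with summable majorant `g`: for
`n ≥ N` and all `k`, the number `g n` bounds the norms of `(lam k / lam (k + n)) • z n`, the image
of `(lam (k + n))⁻¹ • z (k + n)` under `lam k • T ^ k`, and of `(lam (k + n) / lam k) • T ^ n (z 0)`,
the image of `(lam k)⁻¹ • z k` under `lam (k + n) • T ^ (k + n)`. -/
structure IsMajorizedOrbit (T : X →L[ℂ] X) (lam : ℕ → ℂ) (z : ℕ → X) (g : ℕ → ℝ) (N : ℕ) :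
    Prop where
  map_succ : ∀ n, T (z (n + 1)) = z n
  nonneg : ∀ n, 0 ≤ g n
  summable : Summable g
  backward : ∀ n, N ≤ n → ∀ k, ‖lam k / lam (k + n)‖ * ‖z n‖ ≤ g n
  forward : ∀ n, N ≤ n → ∀ k, ‖lam (k + n) / lam k‖ * ‖(T ^ n) (z 0)‖ ≤ g n

/-- The sum of `g n` over `n ≥ M`. -/
noncomputable def tailSum (g : ℕ → ℝ) (M : ℕ) : ℝ := ∑' n, (Set.Ici M).indicator g n

theorem tendsto_tailSum {g : ℕ → ℝ} (hg0 : ∀ n, 0 ≤ g n) (hg : Summable g) :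
    Filter.Tendsto (tailSum g) Filter.atTop (nhds 0) := by
  have h : Filter.Tendsto (tailSum g) Filter.atTop (nhds (∑' _ : ℕ, (0 : ℝ))) := by
    refine tendsto_tsum_of_dominated_convergence hg (fun n => ?_)
      (Filter.Eventually.of_forall fun M n => ?_)
    · refine tendsto_const_nhds.congr' ?_
      filter_upwards [Filter.eventually_gt_atTop n] with M hM
      rw [Set.indicator_of_notMem]
      simpa using hM
    · rw [Real.norm_eq_abs, abs_of_nonneg (Set.indicator_nonneg (fun m _ => hg0 m) n)]
      exact Set.indicator_le_self' (fun m _ => hg0 m) n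
  simpa using h

namespace IsMajorizedOrbit

variable {T : X →L[ℂ] X} {lam : ℕ → ℂ} {z : ℕ → X} {g : ℕ → ℝ} {N : ℕ}

theorem pow_apply_add (h : IsMajorizedOrbit T lam z g N) (k n : ℕ) :
    (T ^ k) (z (k + n)) = z n := by
  induction k generalizing n with
  | zero => simp
  | succ k ih =>
    rw [pow_succ, mul_apply_eq_comp, show k + 1 + n = (k + n) + 1 by omega,
      h.map_succ, ih]

/-- The contribution of the times `n ∈ A` to the universal vector. -/
noncomputable def block (lam : ℕ → ℂ) (z : ℕ → X) (A : Set ℕ) : X :=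
  ∑' n, A.indicator (fun n => (lam n)⁻¹ • z n) n

theorem summable_tail (h : IsMajorizedOrbit T lam z g N) (M : ℕ) :
    Summable ((Set.Ici M).indicator g) := h.summable.indicator _

theorem norm_block_term_le (h : IsMajorizedOrbit T lam z g N) (h0 : lam 0 = 1) {A : Set ℕ} {M : ℕ}
    (hM : N ≤ M) (hA : ∀ n ∈ A, M ≤ n) (n : ℕ) :
    ‖A.indicator (fun n => (lam n)⁻¹ • z n) n‖ ≤ (Set.Ici M).indicator g n := by
  by_cases hn : n ∈ A
  · rw [Set.indicator_of_mem hn, Set.indicator_of_mem (Set.mem_Ici.2 (hA n hn)), norm_smul]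
    simpa [h0] using h.backward n (hM.trans (hA n hn)) 0
  · rw [Set.indicator_of_notMem hn, norm_zero]
    exact Set.indicator_nonneg (fun m _ => h.nonneg m) n

theorem norm_block_le (h : IsMajorizedOrbit T lam z g N) (h0 : lam 0 = 1) {A : Set ℕ} {M : ℕ}
    (hM : N ≤ M) (hA : ∀ n ∈ A, M ≤ n) : ‖block lam z A‖ ≤ tailSum g M :=
  tsum_of_norm_bounded (h.summable_tail M).hasSum (h.norm_block_term_le h0 hM hA)

variable [CompleteSpace X]

/-- At a time `k` that keeps distance at least `M` from the other elements of `A`, the operator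
`lam k • T ^ k` sends the block of `A` close to `z 0` or to `0`, according to whether `k ∈ A`. -/
theorem norm_apply_block_sub_le (h : IsMajorizedOrbit T lam z g N) (h0 : lam 0 = 1)
    (hlam : ∀ n, lam n ≠ 0) {A : Set ℕ} {M : ℕ} (hN : ∀ n ∈ A, N ≤ n) (hM : N ≤ M) (k : ℕ)
    (hk : ∀ n ∈ A, n = k ∨ n + M ≤ k ∨ k + M ≤ n) :
    ‖(lam k • T ^ k) (block lam z A) - A.indicator (fun _ => z 0) k‖ ≤ 2 * tailSum g M := by
  set F : ℕ → X := A.indicator (fun n => (lam n)⁻¹ • z n) with hF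
  set gM : ℕ → ℝ := (Set.Ici M).indicator g with hgM
  have hgM0 : ∀ n, 0 ≤ gM n := fun n => Set.indicator_nonneg (fun m _ => h.nonneg m) n
  have hgMs : Summable gM := h.summable_tail M
  have hFs : Summable F := Summable.of_norm_bounded (h.summable_tail N)
    (h.norm_block_term_le h0 le_rfl hN)
  set H : ℕ → ℝ := fun n => if n < k then gM (k - n) else gM (n - k) with hH
  have hHshift : ∀ n, H (n + k) = gM n := fun n => by simp [hH]
  have hHs : Summable H := by
    rw [← summable_nat_add_iff k]
    simpa only [hHshift] using hgMs
  have hHsum : ∑' n, H n ≤ 2 * tailSum g M := by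
    rw [← hHs.sum_add_tsum_nat_add k]
    have h1 : ∑ n ∈ Finset.range k, H n ≤ tailSum g M := by
      have e1 : ∑ n ∈ Finset.range k, H n = ∑ n ∈ Finset.range k, gM (k - 1 - n + 1) := by
        refine Finset.sum_congr rfl fun n hn => ?_
        have hn' := Finset.mem_range.1 hn
        simp only [hH, hn', if_true]
        congr 1
        omega
      rw [e1, Finset.sum_range_reflect (fun n => gM (n + 1)) k]
      have e2 : ∑ n ∈ Finset.range k, gM (n + 1) ≤ ∑ n ∈ Finset.range (k + 1), gM n := by
        rw [Finset.sum_range_succ']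
        linarith [hgM0 0]
      exact e2.trans (hgMs.sum_le_tsum _ fun n _ => hgM0 n)
    have h2 : ∑' n, H (n + k) = tailSum g M := by simp only [hHshift]; rfl
    rw [h2]
    linarith
  have hsum : HasSum (fun n => (lam k • T ^ k) (F n)
      - (if n = k then A.indicator (fun _ => z 0) k else 0))
      ((lam k • T ^ k) (block lam z A) - A.indicator (fun _ => z 0) k) :=
    (hFs.hasSum.mapL (lam k • T ^ k)).sub (hasSum_ite_eq k _)
  rw [← hsum.tsum_eq]
  refine (tsum_of_norm_bounded hHs.hasSum fun n => ?_).trans hHsum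
  by_cases hn : n ∈ A
  · rw [hF, Set.indicator_of_mem hn]
    rcases eq_or_ne n k with rfl | hne
    · have hz : (T ^ n) (z n) = z 0 := by simpa using h.pow_apply_add n 0
      simp [Set.indicator_of_mem hn, hz, smul_smul, hlam n, hH, hgM0]
    · rcases (hk n hn).resolve_left hne with hlt | hlt
      · obtain ⟨m, rfl⟩ : ∃ m, k = n + m := ⟨k - n, by omega⟩
        have hm : M ≤ m := by omega
        have hz : (T ^ (n + m)) (z n) = (T ^ m) (z 0) := by
          rw [add_comm, pow_add, mul_apply_eq_comp]
          congr 1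
          simpa using h.pow_apply_add n 0
        have hHn : H n = g m := by
          simp [hH, show 0 < m by omega, hgM, hm]
        rw [hHn, if_neg hne, sub_zero, map_smul, smul_apply, hz, smul_smul, norm_smul,
          inv_mul_eq_div]
        exact h.forward m (hM.trans hm) n
      · obtain ⟨m, rfl⟩ : ∃ m, n = k + m := ⟨n - k, by omega⟩
        have hm : M ≤ m := by omega
        have hHn : H (k + m) = g m := by
          simp [hH, hgM, hm]
        rw [hHn, if_neg hne, sub_zero, map_smul, smul_apply, h.pow_apply_add, smul_smul,
          norm_smul, inv_mul_eq_div]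
        exact h.backward m (hM.trans hm) k
  · have hn0 : (if n = k then A.indicator (fun _ => z 0) k else 0) = 0 := by
      split_ifs with hnk
      · rw [← hnk, Set.indicator_of_notMem hn]
      · rfl
    rw [hn0, hF, Set.indicator_of_notMem hn, map_zero, sub_zero, norm_zero]
    simp only [hH]
    split_ifs <;> exact hgM0 _

end IsMajorizedOrbit

/-! ### A criterion for frequent universality -/

/-- The vectors with a backward orbit that has a summable majorant form a subspace. -/
def majorizedVectors (T : X →L[ℂ] X) (lam : ℕ → ℂ) : Submodule ℂ X where
  carrier := {y | ∃ z g N, z 0 = y ∧ IsMajorizedOrbit T lam z g N}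
  zero_mem' := ⟨0, 0, 0, rfl, ⟨by simp, by simp, summable_zero, by simp, by simp⟩⟩
  add_mem' := by
    rintro _ _ ⟨z, g, N, rfl, h⟩ ⟨z', g', N', rfl, h'⟩
    refine ⟨z + z', g + g', max N N', rfl, fun n => ?_,
      fun n => add_nonneg (h.nonneg n) (h'.nonneg n), h.summable.add h'.summable,
      fun n hn k => ?_, fun n hn k => ?_⟩
    · simp [h.map_succ, h'.map_succ]
    · have h1 := h.backward n (by omega) k
      have h2 := h'.backward n (by omega) k
      have h3 := mul_le_mul_of_nonneg_left (norm_add_le (z n) (z' n))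
        (norm_nonneg (lam k / lam (k + n)))
      simp only [Pi.add_apply]
      linarith
    · have h1 := h.forward n (by omega) k
      have h2 := h'.forward n (by omega) k
      have h3 := mul_le_mul_of_nonneg_left (norm_add_le ((T ^ n) (z 0)) ((T ^ n) (z' 0)))
        (norm_nonneg (lam (k + n) / lam k))
      simp only [Pi.add_apply, map_add]
      linarith
  smul_mem' := by
    rintro c _ ⟨z, g, N, rfl, h⟩
    refine ⟨c • z, fun n => ‖c‖ * g n, N, rfl, fun n => ?_,
      fun n => mul_nonneg (norm_nonneg c) (h.nonneg n), h.summable.mul_left _,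
      fun n hn k => ?_, fun n hn k => ?_⟩
    · simp [h.map_succ]
    · have h1 := mul_le_mul_of_nonneg_left (h.backward n hn k) (norm_nonneg c)
      simp only [Pi.smul_apply, norm_smul]
      linarith
    · have h1 := mul_le_mul_of_nonneg_left (h.forward n hn k) (norm_nonneg c)
      simp only [Pi.smul_apply, map_smul, norm_smul]
      linarith

/-- If the vectors having a backward orbit with a summable majorant are dense, the operators
`lam n • T ^ n` are frequently universal: place the vectors `(lam n)⁻¹ • z n` of countably many
such orbits at the times `n` of separated sets of positive lower density. -/
theorem frequentlyUniversal_of_dense_majorizedVectors [CompleteSpace X]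
    [TopologicalSpace.SeparableSpace X] (T : X →L[ℂ] X) (lam : ℕ → ℂ) (h0 : lam 0 = 1)
    (hlam : ∀ n, lam n ≠ 0) (hdense : Dense (majorizedVectors T lam : Set X)) :
    FrequentlyUniversal (fun n => lam n • T ^ n) := by
  have : SecondCountableTopology X := UniformSpace.secondCountable_of_separable X
  let d : ℕ → majorizedVectors T lam :=
    fun p => TopologicalSpace.denseSeq (majorizedVectors T lam) p.unpair.1
  -- Every tail of the sequence `d` is dense, as each value is taken infinitely often.
  have hd : ∀ y : X, ∀ ε > 0, ∀ m : ℕ, ∃ p ≥ m, ‖(d p : X) - y‖ < ε := by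
    intro y ε hε m
    obtain ⟨y', hy'⟩ := Metric.dense_iff.1 hdense y (ε / 2) (half_pos hε)
    obtain ⟨i, hi⟩ := (TopologicalSpace.denseRange_denseSeq (majorizedVectors T lam)).exists_dist_lt
      ⟨y', hy'.2⟩ (half_pos hε)
    refine ⟨Nat.pair i m, Nat.right_le_pair i m, ?_⟩
    have h1 : d (Nat.pair i m) = TopologicalSpace.denseSeq (majorizedVectors T lam) i := by
      simp [d]
    rw [h1, ← dist_eq_norm]
    have h2 := Metric.mem_ball.1 hy'.1
    rw [Subtype.dist_eq, dist_comm] at hi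
    have h3 := dist_triangle
      (TopologicalSpace.denseSeq (majorizedVectors T lam) i : X) y' y
    simp only at hi
    linarith
  have hdata : ∀ p, ∃ z g N, z 0 = (d p : X) ∧ IsMajorizedOrbit T lam z g N := fun p => (d p).2
  choose z g N hz h using hdata
  have hpow : ∀ p : ℕ, (0 : ℝ) < (1 / 2) ^ p := fun p => by positivity
  -- The separation `φ q` assigned to `d q` makes the tails of all earlier majorants small.
  obtain ⟨φ, hφmono, hφ⟩ : ∃ φ : ℕ → ℕ, StrictMono φ ∧ ∀ q, ∀ p ∈ Finset.range (q + 1),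
      N p ≤ φ q ∧ tailSum (g p) (φ q) ≤ (1 / 2) ^ q * (1 / 2) ^ q := by
    refine Filter.extraction_forall_of_eventually (P := fun q M => ∀ p ∈ Finset.range (q + 1),
      N p ≤ M ∧ tailSum (g p) M ≤ (1 / 2) ^ q * (1 / 2) ^ q) fun q => ?_
    refine (Filter.eventually_all_finset _).2 fun p _ => ?_
    refine (Filter.eventually_ge_atTop (N p)).and ?_
    refine ((tendsto_tailSum (h p).nonneg (h p).summable).eventually_lt_const
      (mul_pos (hpow q) (hpow q))).mono fun M hM => hM.le
  have hN : ∀ p q, N p ≤ max (φ p) (φ q) := fun p q =>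
    (hφ p p (by simp)).1.trans (le_max_left _ _)
  have htail : ∀ p q, tailSum (g p) (max (φ p) (φ q)) ≤ (1 / 2) ^ p * (1 / 2) ^ q := by
    intro p q
    have hanti : ∀ {i j : ℕ}, i ≤ j → ((1 : ℝ) / 2) ^ j ≤ (1 / 2) ^ i := fun hij =>
      pow_le_pow_of_le_one (by norm_num) (by norm_num) hij
    rcases le_total p q with hpq | hpq
    · rw [max_eq_right (hφmono.monotone hpq)]
      refine (hφ q p (Finset.mem_range.2 (by omega))).2.trans ?_
      exact mul_le_mul_of_nonneg_right (hanti hpq) (hpow q).le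
    · rw [max_eq_left (hφmono.monotone hpq)]
      refine (hφ p p (by simp)).2.trans ?_
      exact mul_le_mul_of_nonneg_left (hanti hpq) (hpow p).le
  obtain ⟨pos, hpos1, hposv, hposinj, hposlin, hpossep⟩ := exists_separated_positions
  set A : ℕ → Set ℕ := fun p => Set.range (pos (φ p)) with hA
  set b : ℕ → X := fun p => IsMajorizedOrbit.block lam (z p) (A p) with hb
  have hgeom : HasSum (fun p : ℕ => ((1 : ℝ) / 2) ^ p) 2 := hasSum_geometric_two
  have hAφ : ∀ p, ∀ n ∈ A p, φ p ≤ n := by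
    rintro p _ ⟨i, rfl⟩
    exact hposv _ _
  have hNφ : ∀ p, N p ≤ φ p := fun p => (hφ p p (by simp)).1
  have hbs : Summable b := by
    refine Summable.of_norm_bounded hgeom.summable fun p => ?_
    refine ((h p).norm_block_le h0 (hNφ p) (hAφ p)).trans ?_
    refine (hφ p p (by simp)).2.trans ?_
    exact mul_le_of_le_one_left (hpow p).le (pow_le_one₀ (by norm_num) (by norm_num))
  have happrox : ∀ q i, ‖(lam (pos (φ q) i) • T ^ (pos (φ q) i)) (∑' p, b p) - d q‖
      ≤ 4 * (1 / 2) ^ q := by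
    intro q i
    set k := pos (φ q) i with hk
    have hsum : HasSum (fun p => (lam k • T ^ k) (b p) - (if p = q then (d q : X) else 0))
        ((lam k • T ^ k) (∑' p, b p) - d q) :=
      (hbs.hasSum.mapL (lam k • T ^ k)).sub (hasSum_ite_eq q _)
    have hmaj : HasSum (fun p : ℕ => 2 * ((1 / 2 : ℝ) ^ p * (1 / 2) ^ q)) (2 * (2 * (1 / 2) ^ q)) :=
      (hgeom.mul_right _).mul_left _
    rw [← hsum.tsum_eq]
    refine (tsum_of_norm_bounded hmaj fun p => ?_).trans (by linarith)
    have hind : (if p = q then (d q : X) else 0) = (A p).indicator (fun _ => z p 0) k := by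
      split_ifs with hpq
      · rw [Set.indicator_of_mem (by rw [hpq]; exact ⟨i, rfl⟩), hz, hpq]
      · rw [Set.indicator_of_notMem]
        rintro ⟨j, hj⟩
        rcases hpossep (φ p) (φ q) j i with ⟨he, _⟩ | hlt | hlt
        · exact hpq (hφmono.injective he)
        all_goals omega
    rw [hind]
    refine ((h p).norm_apply_block_sub_le h0 hlam (fun n hn => (hNφ p).trans (hAφ p n hn))
      (hN p q) k ?_).trans (mul_le_mul_of_nonneg_left (htail p q) (by norm_num))
    rintro _ ⟨j, rfl⟩
    rcases hpossep (φ p) (φ q) j i with ⟨he, hji⟩ | hlt | hlt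
    · left
      rw [hk, he, hji]
    · exact Or.inr (Or.inl hlt.le)
    · exact Or.inr (Or.inr hlt.le)
  refine ⟨∑' p, b p, fun U hU hUne => ?_⟩
  obtain ⟨y, hy⟩ := hUne
  obtain ⟨ε, hε, hball⟩ := Metric.isOpen_iff.1 hU y hy
  obtain ⟨m, hm⟩ := exists_pow_lt_of_lt_one (show 0 < ε / 8 by positivity)
    (show (1 / 2 : ℝ) < 1 by norm_num)
  obtain ⟨q, hqm, hq⟩ := hd y (ε / 2) (half_pos hε) m
  obtain ⟨D, hD⟩ := hposlin (φ q)
  refine lowerDensity_pos_of_linear_growth (pos (φ q)) (hposinj _) (fun i => hball ?_)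
    (hpos1 _) D hD
  rw [Metric.mem_ball, dist_eq_norm]
  have h1 := happrox q i
  have h2 : ((1 : ℝ) / 2) ^ q ≤ (1 / 2) ^ m :=
    pow_le_pow_of_le_one (by norm_num) (by norm_num) hqm
  have h3 := norm_add_le ((lam (pos (φ q) i) • T ^ (pos (φ q) i)) (∑' p, b p) - (d q : X))
    ((d q : X) - y)
  rw [sub_add_sub_cancel] at h3
  linarith

end Criterion

/-! ### Weighted shifts on `ℓ¹` -/

section WeightedShift

variable {ι : Type}

theorem summable_norm_lp_one (f : lp (fun _ : ι => ℂ) 1) : Summable fun i => ‖f i‖ := by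
  simpa using (lp.hasSum_norm (p := 1) (by simp) f).summable

theorem norm_lp_one (f : lp (fun _ : ι => ℂ) 1) : ‖f‖ = ∑' i, ‖f i‖ := by
  simpa using lp.norm_eq_tsum_rpow (p := 1) (by simp) f

/-- The weighted shift of `ℓ¹(ι)` along an injective map `σ`, which sends the unit vector at `σ i`
to `W (σ i) / W i` times the unit vector at `i`. It is thus conjugate by the diagonal matrix `W`
to the unweighted shift, and the weights of its powers are again quotients of values of `W`. -/
noncomputable def weightedShift (σ : ι → ι) (hσ : Function.Injective σ) (W : ι → ℝ) (C : ℝ)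
    (hC : ∀ i, |W (σ i) / W i| ≤ C) : lp (fun _ : ι => ℂ) 1 →L[ℂ] lp (fun _ : ι => ℂ) 1 :=
  have hle : ∀ (f : lp (fun _ : ι => ℂ) 1) (i : ι),
      ‖(W (σ i) / W i) • f (σ i)‖ ≤ C * ‖f (σ i)‖ := fun f i => by
    rw [norm_smul, Real.norm_eq_abs]
    exact mul_le_mul_of_nonneg_right (hC i) (norm_nonneg _)
  have hsum : ∀ f : lp (fun _ : ι => ℂ) 1, Summable fun i => C * ‖f (σ i)‖ := fun f =>
    ((summable_norm_lp_one f).comp_injective hσ).mul_left C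
  LinearMap.mkContinuous
    { toFun := fun f => ⟨fun i => (W (σ i) / W i) • f (σ i), memℓp_gen (by
        simpa using Summable.of_nonneg_of_le (fun i => norm_nonneg _) (hle f) (hsum f))⟩
      map_add' := fun f g => by ext i; exact smul_add _ _ _
      map_smul' := fun c f => by ext i; exact smul_comm (W (σ i) / W i) c (f (σ i)) }
    |C| fun f => by
      have hcomp := (summable_norm_lp_one f).comp_injective hσ
      have hnorm : Summable fun i => ‖(W (σ i) / W i) • f (σ i)‖ :=
        Summable.of_nonneg_of_le (fun i => norm_nonneg _) (hle f) (hsum f)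
      rw [norm_lp_one, norm_lp_one]
      refine (hnorm.tsum_le_tsum (hle f) (hsum f)).trans ?_
      rw [tsum_mul_left]
      refine mul_le_mul (le_abs_self C) ?_ (tsum_nonneg fun i => norm_nonneg _) (abs_nonneg C)
      exact hcomp.tsum_le_tsum_of_inj σ hσ (fun _ _ => norm_nonneg _) (fun _ => le_rfl)
        (summable_norm_lp_one f)

variable {σ : ι → ι} {hσ : Function.Injective σ} {W : ι → ℝ} {C : ℝ}
  {hC : ∀ i, |W (σ i) / W i| ≤ C}

theorem weightedShift_apply (f : lp (fun _ : ι => ℂ) 1) (i : ι) :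
    weightedShift σ hσ W C hC f i = (W (σ i) / W i) • f (σ i) := rfl

theorem weightedShift_pow_apply (hW : ∀ i, W i ≠ 0) (n : ℕ) (f : lp (fun _ : ι => ℂ) 1) (i : ι) :
    (weightedShift σ hσ W C hC ^ n) f i = (W (σ^[n] i) / W i) • f (σ^[n] i) := by
  induction n generalizing i with
  | zero => simp [hW i]
  | succ n ih =>
    rw [pow_succ', mul_apply_eq_comp, weightedShift_apply, ih, smul_smul,
      Function.iterate_succ_apply]
    congr 1
    have h1 := hW i
    have h2 := hW (σ i)
    field_simp

variable [DecidableEq ι]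

theorem weightedShift_pow_single (hW : ∀ i, W i ≠ 0) (n : ℕ) (i : ι) :
    (weightedShift σ hσ W C hC ^ n) (lp.single 1 (σ^[n] i) 1)
      = (W (σ^[n] i) / W i) • lp.single 1 i (1 : ℂ) := by
  ext l
  rw [weightedShift_pow_apply hW, lp.coeFn_smul, Pi.smul_apply]
  rcases eq_or_ne l i with rfl | hl
  · simp
  · rw [lp.single_apply_ne _ _ _ hl, lp.single_apply_ne _ _ _ ((hσ.iterate n).ne hl)]
    simp

theorem weightedShift_pow_single_of_notMem_range (hW : ∀ i, W i ≠ 0) (n : ℕ) (j : ι)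
    (hj : ∀ i, σ^[n] i ≠ j) :
    (weightedShift σ hσ W C hC ^ n) (lp.single 1 j 1) = 0 := by
  ext l
  rw [weightedShift_pow_apply hW, lp.single_apply_ne _ _ _ (hj l)]
  simp

/-- A unit vector has the backward orbit of multiples of the unit vectors at `σ^[n] j`; whether
that orbit has a summable majorant is a condition on the weights. -/
theorem single_mem_majorizedVectors (hW : ∀ i, W i ≠ 0) {lam : ℕ → ℂ} {j : ι} (g : ℕ → ℝ) (N : ℕ)
    (hg0 : ∀ n, 0 ≤ g n) (hg : Summable g)
    (hback : ∀ n, N ≤ n → ∀ k, ‖lam k / lam (k + n)‖ * |W j / W (σ^[n] j)| ≤ g n)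
    (hforw : ∀ n, N ≤ n → ∀ k i, σ^[n] i = j → ‖lam (k + n) / lam k‖ * |W j / W i| ≤ g n) :
    lp.single 1 j (1 : ℂ) ∈ majorizedVectors (weightedShift σ hσ W C hC) lam := by
  let z : ℕ → lp (fun _ : ι => ℂ) 1 := fun n => (W j / W (σ^[n] j)) • lp.single 1 (σ^[n] j) 1
  have hz0 : z 0 = lp.single 1 j 1 := by
    change (W j / W j) • lp.single (E := fun _ : ι => ℂ) 1 j (1 : ℂ) = lp.single 1 j 1
    rw [div_self (hW j), one_smul]
  have hnorm : ∀ (r : ℝ) (i : ι), ‖r • lp.single (E := fun _ : ι => ℂ) 1 i (1 : ℂ)‖ = |r| := by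
    intro r i
    rw [norm_smul, lp.norm_single (by simp), norm_one, mul_one, Real.norm_eq_abs]
  refine ⟨z, g, N, hz0, ⟨fun n => ?_, hg0, hg,
    fun n hn k => ?_, fun n hn k => ?_⟩⟩
  · have h := weightedShift_pow_single (hσ := hσ) (hC := hC) hW 1 (σ^[n] j)
    simp only [pow_one, Function.iterate_one] at h
    change weightedShift σ hσ W C hC ((W j / W (σ^[n + 1] j)) • lp.single 1 (σ^[n + 1] j) 1)
      = (W j / W (σ^[n] j)) • lp.single 1 (σ^[n] j) 1
    rw [Function.iterate_succ_apply', ContinuousLinearMap.map_smul_of_tower, h, smul_smul]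
    congr 1
    have h1 := hW (σ (σ^[n] j))
    field_simp
  · change _ * ‖(W j / W (σ^[n] j)) • lp.single (E := fun _ : ι => ℂ) 1 (σ^[n] j) (1 : ℂ)‖ ≤ _
    rw [hnorm]
    exact hback n hn k
  · rw [hz0]
    by_cases hj : ∃ i, σ^[n] i = j
    · obtain ⟨i, rfl⟩ := hj
      rw [weightedShift_pow_single hW, hnorm]
      exact hforw n hn k i rfl
    · rw [weightedShift_pow_single_of_notMem_range hW n j (not_exists.1 hj)]
      simpa using hg0 n

/-- No power of the shift returns to the ball of radius `1/2` about a unit vector if all weights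
into that coordinate are at most one. -/
theorem not_isRecurrentOperator_weightedShift_of_le_one (hW : ∀ i, W i ≠ 0) (i₀ : ι)
    (h : ∀ k, 1 ≤ k → σ^[k] i₀ ≠ i₀ ∧ |W (σ^[k] i₀) / W i₀| ≤ 1) :
    ¬ IsRecurrentOperator (weightedShift σ hσ W C hC) := by
  intro hrec
  obtain ⟨k, hk, x, hx, hTx⟩ := hrec (Metric.ball (lp.single 1 i₀ 1) (1 / 2)) Metric.isOpen_ball
    ⟨_, Metric.mem_ball_self (by norm_num)⟩
  obtain ⟨hne, hle⟩ := h k hk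
  rw [Set.mem_preimage, Metric.mem_ball, dist_eq_norm] at hTx
  rw [Metric.mem_ball, dist_eq_norm] at hx
  have h1 := (lp.norm_apply_le_norm one_ne_zero _ (σ^[k] i₀)).trans_lt hx
  have h2 := (lp.norm_apply_le_norm one_ne_zero _ i₀).trans_lt hTx
  rw [lp.coeFn_sub, Pi.sub_apply, lp.single_apply_ne _ _ _ hne, sub_zero] at h1
  rw [lp.coeFn_sub, Pi.sub_apply, lp.single_apply_self, weightedShift_pow_apply hW,
    norm_sub_rev] at h2
  have h3 := norm_sub_norm_le (1 : ℂ) ((W (σ^[k] i₀) / W i₀) • x (σ^[k] i₀))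
  rw [norm_one, norm_smul, Real.norm_eq_abs] at h3
  have h4 := mul_le_of_le_one_left (norm_nonneg (x (σ^[k] i₀))) hle
  linarith

/-- No power of the shift returns to the ball of radius `1/2` about a unit vector if all weights
out of that coordinate are at least one. -/
theorem not_isRecurrentOperator_weightedShift_of_one_le (hW : ∀ i, W i ≠ 0) (i₀ : ι)
    (h : ∀ k, 1 ≤ k → ∃ i, i ≠ i₀ ∧ σ^[k] i = i₀ ∧ 1 ≤ |W i₀ / W i|) :
    ¬ IsRecurrentOperator (weightedShift σ hσ W C hC) := by
  intro hrec
  obtain ⟨k, hk, x, hx, hTx⟩ := hrec (Metric.ball (lp.single 1 i₀ 1) (1 / 2)) Metric.isOpen_ball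
    ⟨_, Metric.mem_ball_self (by norm_num)⟩
  obtain ⟨i, hne, hi, hle⟩ := h k hk
  rw [Set.mem_preimage, Metric.mem_ball, dist_eq_norm] at hTx
  rw [Metric.mem_ball, dist_eq_norm] at hx
  have h1 := (lp.norm_apply_le_norm one_ne_zero _ i₀).trans_lt hx
  have h2 := (lp.norm_apply_le_norm one_ne_zero _ i).trans_lt hTx
  rw [lp.coeFn_sub, Pi.sub_apply, lp.single_apply_self, norm_sub_rev] at h1
  rw [lp.coeFn_sub, Pi.sub_apply, lp.single_apply_ne _ _ _ hne, sub_zero,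
    weightedShift_pow_apply hW, hi, norm_smul, Real.norm_eq_abs] at h2
  have h3 := norm_sub_norm_le (1 : ℂ) (x i₀)
  rw [norm_one] at h3
  have h4 := le_mul_of_one_le_left (norm_nonneg (x i₀)) hle
  linarith

theorem dense_of_single_mem (D : Submodule ℂ (lp (fun _ : ι => ℂ) 1))
    (hD : ∀ j, lp.single 1 j (1 : ℂ) ∈ D) : Dense (D : Set (lp (fun _ : ι => ℂ) 1)) := by
  intro f
  refine mem_closure_of_tendsto (lp.hasSum_single (by simp) f)
    (Filter.Eventually.of_forall fun s => D.sum_mem fun i _ => ?_)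
  have h : lp.single (E := fun _ : ι => ℂ) 1 i (f i) = f i • lp.single 1 i (1 : ℂ) := by
    rw [← lp.single_smul, smul_eq_mul, mul_one]
  rw [h]
  exact D.smul_mem _ (hD i)

end WeightedShift

theorem separableSpace_lp_one (ι : Type) [Countable ι] :
    TopologicalSpace.SeparableSpace (lp (fun _ : ι => ℂ) 1) := by
  classical
  rw [← TopologicalSpace.isSeparable_univ_iff]
  have h := dense_of_single_mem
    (Submodule.span ℂ (Set.range fun j : ι => lp.single (E := fun _ : ι => ℂ) 1 j (1 : ℂ)))
    fun j => Submodule.subset_span ⟨j, rfl⟩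
  rw [← h.closure_eq]
  exact ((Set.countable_range _).isSeparable.span (R := ℂ)).closure

theorem not_finiteDimensional_lp_one (ι : Type) [Infinite ι] :
    ¬ FiniteDimensional ℂ (lp (fun _ : ι => ℂ) 1) := by
  classical
  intro hfin
  have hlin : LinearIndependent ℂ fun j : ι => lp.single (E := fun _ : ι => ℂ) 1 j (1 : ℂ) := by
    rw [linearIndependent_iff']
    intro s c hc i hi
    let ev := lp.evalₗ (𝕜 := ℂ) (fun _ : ι => ℂ) 1 i
    have hev : ∀ l, ev (lp.single 1 l 1) = if l = i then 1 else 0 := fun l => by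
      split_ifs with hl
      · rw [hl]
        exact lp.single_apply_self (E := fun _ : ι => ℂ) 1 i 1
      · exact lp.single_apply_ne (E := fun _ : ι => ℂ) 1 l 1 (Ne.symm hl)
    have h := congrArg ev hc
    simpa [map_sum, map_smul, hev, hi] using h
  exact not_finite_iff_infinite.2 ‹Infinite ι›
    (Module.Finite.finite_basis (R := ℂ) (Module.Basis.span hlin))

/-! ### The case of superexponential growth -/

/-- The majorant for the backward orbit of the `j`-th unit vector, for the weights
`W i = (i !)⁻¹` and the multipliers `n ! * 2 ^ n`; it does not depend on `k`. -/
theorem factorial_ratio_mul_le_choose (j n k : ℕ) :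
    ‖((k.factorial * 2 ^ k : ℝ) : ℂ) / (((k + n).factorial * 2 ^ (k + n) : ℝ) : ℂ)‖
      * |(j.factorial : ℝ)⁻¹ / ((j + n).factorial : ℝ)⁻¹|
      ≤ ((n + j).choose j : ℝ) * (1 / 2) ^ n := by
  have hk : (k.factorial * n.factorial : ℝ) ≤ (k + n).factorial := by
    exact_mod_cast Nat.le_of_dvd (Nat.factorial_pos _)
      (Nat.factorial_mul_factorial_dvd_factorial_add k n)
  have hc : ((n + j).choose j * j.factorial * n.factorial : ℝ) = (j + n).factorial := by
    have := Nat.add_choose_mul_factorial_mul_factorial n j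
    rw [add_comm j n]
    rw [mul_right_comm] at this
    exact_mod_cast this
  have p1 : (0 : ℝ) < k.factorial := by exact_mod_cast k.factorial_pos
  have p2 : (0 : ℝ) < (k + n).factorial := by exact_mod_cast (k + n).factorial_pos
  have p3 : (0 : ℝ) < j.factorial := by exact_mod_cast j.factorial_pos
  rw [← hc, ← Complex.ofReal_div, Complex.norm_real, Real.norm_eq_abs,
    abs_of_nonneg (by positivity), abs_of_nonneg (by positivity)]
  have e : (k.factorial * 2 ^ k : ℝ) / ((k + n).factorial * 2 ^ (k + n))
      * ((j.factorial : ℝ)⁻¹ / ((n + j).choose j * j.factorial * n.factorial : ℝ)⁻¹)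
      = ((k.factorial * n.factorial : ℝ) / (k + n).factorial)
        * (((n + j).choose j : ℝ) * (1 / 2) ^ n) := by
    rw [pow_add, one_div, inv_pow]
    field_simp
  rw [e]
  exact mul_le_of_le_one_left (by positivity) ((div_le_one p2).2 hk)

/-- As `lam (k + n) / lam k` is unbounded in `k`, a majorant for the forward orbits exists only
because these vanish eventually; hence the unilateral shift. -/
theorem exists_weightedShift_of_zero (τ : ℕ) (hτ : 1 ≤ τ) :
    ∃ (lam : ℕ → ℂ) (T : lp (fun _ : ℕ => ℂ) 1 →L[ℂ] lp (fun _ : ℕ => ℂ) 1),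
      (∀ n, lam n ≠ 0) ∧
      Filter.Tendsto (fun n => ‖lam n‖ / ‖lam (n + τ)‖) Filter.atTop (nhds 0) ∧
      FrequentlyUniversal (fun n => lam n • T ^ n) ∧ ¬ IsRecurrentOperator T := by
  have := separableSpace_lp_one ℕ
  have hfac : ∀ n : ℕ, (0 : ℝ) < n.factorial := fun n => by exact_mod_cast n.factorial_pos
  set W : ℕ → ℝ := fun i => (i.factorial : ℝ)⁻¹ with hWdef
  have hWpos : ∀ i, 0 < W i := fun i => inv_pos.2 (hfac i)
  have hW : ∀ i, W i ≠ 0 := fun i => (hWpos i).ne'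
  have hWle : ∀ {i j}, i ≤ j → |W j / W i| ≤ 1 := fun {i j} hij => by
    rw [abs_of_nonneg (div_nonneg (hWpos j).le (hWpos i).le), div_le_one (hWpos i)]
    exact inv_anti₀ (hfac i) (by exact_mod_cast Nat.factorial_le hij)
  have hiter : ∀ n i : ℕ, Nat.succ^[n] i = i + n := fun n i => by
    rw [Nat.succ_iterate]
  set lam : ℕ → ℂ := fun n => ((n.factorial * 2 ^ n : ℝ) : ℂ) with hlamdef
  have hlampos : ∀ n : ℕ, (0 : ℝ) < n.factorial * 2 ^ n := fun n => mul_pos (hfac n) (by positivity)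
  have hlam : ∀ n, lam n ≠ 0 := fun n => Complex.ofReal_ne_zero.2 (hlampos n).ne'
  have hnorm : ∀ n, ‖lam n‖ = n.factorial * 2 ^ n := fun n => by
    rw [hlamdef, Complex.norm_real, Real.norm_eq_abs, abs_of_pos (hlampos n)]
  refine ⟨lam, weightedShift Nat.succ Nat.succ_injective W 1 fun i => hWle (Nat.le_succ i), hlam,
    ?_, ?_, ?_⟩
  · refine squeeze_zero (fun n => by positivity) (fun n => ?_)
      tendsto_one_div_add_atTop_nhds_zero_nat
    rw [hnorm, hnorm, div_le_div_iff₀ (hlampos _) (by positivity), one_mul]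
    have h1 : ((n + 1) * n.factorial : ℝ) ≤ (n + τ).factorial := by
      exact_mod_cast (Nat.factorial_succ n).symm.trans_le (Nat.factorial_le (by omega))
    have h2 : (2 : ℝ) ^ n ≤ 2 ^ (n + τ) := pow_le_pow_right₀ (by norm_num) (by omega)
    calc (n.factorial * 2 ^ n * (n + 1) : ℝ) = ((n + 1) * n.factorial) * 2 ^ n := by ring
      _ ≤ (n + τ).factorial * 2 ^ (n + τ) := mul_le_mul h1 h2 (by positivity) (hfac _).le
  · refine frequentlyUniversal_of_dense_majorizedVectors _ _ (by simp [hlamdef]) hlam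
      (dense_of_single_mem _ fun j => ?_)
    refine single_mem_majorizedVectors hW (fun n => ((n + j).choose j : ℝ) * (1 / 2) ^ n) (j + 1)
      (fun n => by positivity) (summable_choose_mul_geometric_of_norm_lt_one j (by norm_num))
      (fun n _ k => ?_) (fun n hn k i hi => ?_)
    · rw [hiter]
      exact factorial_ratio_mul_le_choose j n k
    -- The `j`-th unit vector is annihilated by the powers of the shift beyond the `j`-th.
    · rw [hiter] at hi
      omega
  · refine not_isRecurrentOperator_weightedShift_of_le_one hW 0 fun k hk => ?_
    rw [hiter]
    exact ⟨by omega, hWle (Nat.zero_le _)⟩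

/-! ### The case of geometric growth -/

/-- The weights `v ^ i` for `i ≥ 0` and `u ^ i` for `i < 0`. -/
noncomputable def twoSidedWeight (u v : ℝ) (i : ℤ) : ℝ := if 0 ≤ i then v ^ i else u ^ i

section TwoSided

variable {u v : ℝ}

theorem twoSidedWeight_of_nonneg {i : ℤ} (hi : 0 ≤ i) : twoSidedWeight u v i = v ^ i :=
  if_pos hi

theorem twoSidedWeight_of_nonpos {i : ℤ} (hi : i ≤ 0) : twoSidedWeight u v i = u ^ i := by
  rcases hi.lt_or_eq with h | rfl
  · exact if_neg (not_le.2 h)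
  · simp [twoSidedWeight]

theorem twoSidedWeight_pos (hu : 0 < u) (hv : 0 < v) (i : ℤ) : 0 < twoSidedWeight u v i := by
  unfold twoSidedWeight
  split_ifs <;> positivity

theorem twoSidedWeight_step_le (hu : 0 < u) (hv : 0 < v) (i : ℤ) :
    |twoSidedWeight u v (i + 1) / twoSidedWeight u v i| ≤ max u v := by
  rw [abs_of_pos (div_pos (twoSidedWeight_pos hu hv _) (twoSidedWeight_pos hu hv _))]
  rcases le_or_gt 0 i with h | h
  · rw [twoSidedWeight_of_nonneg h, twoSidedWeight_of_nonneg (by omega), zpow_add_one₀ hv.ne',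
      mul_div_cancel_left₀ _ (zpow_ne_zero _ hv.ne')]
    exact le_max_right u v
  · rw [twoSidedWeight_of_nonpos h.le, twoSidedWeight_of_nonpos (by omega), zpow_add_one₀ hu.ne',
      mul_div_cancel_left₀ _ (zpow_ne_zero _ hu.ne')]
    exact le_max_left u v

theorem add_one_iterate (n : ℕ) (i : ℤ) : (fun i : ℤ => i + 1)^[n] i = i + n := by
  induction n with
  | zero => simp
  | succ n ih => rw [Function.iterate_succ_apply', ih]; push_cast; ring

/-- The shift of `ℓ¹(ℤ)` that sends the unit vector at `i + 1` to `v` (if `i ≥ 0`) or `u`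
(if `i < 0`) times the unit vector at `i`. -/
noncomputable def twoSidedShift (hu : 0 < u) (hv : 0 < v) :
    lp (fun _ : ℤ => ℂ) 1 →L[ℂ] lp (fun _ : ℤ => ℂ) 1 :=
  weightedShift (fun i : ℤ => i + 1) (add_left_injective 1) (twoSidedWeight u v) (max u v)
    (twoSidedWeight_step_le hu hv)

/-- From the unit vector at `j`, the terms of the forward orbit multiplied by `c ^ n` decay like
`(c * u) ^ n`, those of the backward orbit divided by `c ^ n` like `(c * v)⁻¹ ^ n`. -/
theorem frequentlyUniversal_twoSidedShift (hu : 0 < u) (hv : 0 < v) {c : ℝ} (hc : 0 < c)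
    (hcu : c * u < 1) (hcv : 1 < c * v) :
    FrequentlyUniversal (fun n => ((c ^ n : ℝ) : ℂ) • twoSidedShift hu hv ^ n) := by
  have := separableSpace_lp_one ℤ
  have hWpos := twoSidedWeight_pos hu hv
  refine frequentlyUniversal_of_dense_majorizedVectors _ (fun n => ((c ^ n : ℝ) : ℂ)) (by simp)
    (fun n => Complex.ofReal_ne_zero.2 (pow_ne_zero n hc.ne'))
    (dense_of_single_mem _ fun j => ?_)
  set A : ℝ := twoSidedWeight u v j * (v ^ j)⁻¹ with hA
  set B : ℝ := twoSidedWeight u v j * (u ^ j)⁻¹ with hB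
  have hA0 : 0 ≤ A := mul_nonneg (hWpos j).le (by positivity)
  have hB0 : 0 ≤ B := mul_nonneg (hWpos j).le (by positivity)
  have hs1 : Summable fun n : ℕ => A * ((c * v)⁻¹) ^ n :=
    (summable_geometric_of_lt_one (by positivity) (inv_lt_one_of_one_lt₀ hcv)).mul_left A
  have hs2 : Summable fun n : ℕ => B * (c * u) ^ n :=
    (summable_geometric_of_lt_one (by positivity) hcu).mul_left B
  refine single_mem_majorizedVectors (fun i => (hWpos i).ne')
    (fun n => A * ((c * v)⁻¹) ^ n + B * (c * u) ^ n) j.natAbs (fun n => by positivity)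
    (hs1.add hs2) (fun n hn k => ?_) (fun n hn k i hi => ?_)
  · rw [add_one_iterate, ← Complex.ofReal_div, Complex.norm_real, Real.norm_eq_abs,
      abs_of_pos (by positivity), abs_of_pos (div_pos (hWpos _) (hWpos _)),
      twoSidedWeight_of_nonneg (i := j + n) (by omega), zpow_add₀ hv.ne', zpow_natCast]
    have e : c ^ k / c ^ (k + n) * (twoSidedWeight u v j / (v ^ j * v ^ n))
        = A * ((c * v)⁻¹) ^ n := by
      rw [hA, pow_add, inv_pow, mul_pow]
      field_simp
    rw [e]
    exact le_add_of_nonneg_right (by positivity)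
  · rw [add_one_iterate] at hi
    obtain rfl : i = j - n := by omega
    rw [← Complex.ofReal_div, Complex.norm_real, Real.norm_eq_abs,
      abs_of_pos (by positivity), abs_of_pos (div_pos (hWpos _) (hWpos _)),
      twoSidedWeight_of_nonpos (i := j - n) (by omega), zpow_sub₀ hu.ne', zpow_natCast]
    have e : c ^ (k + n) / c ^ k * (twoSidedWeight u v j / (u ^ j / u ^ n))
        = B * (c * u) ^ n := by
      rw [hB, pow_add, mul_pow]
      field_simp
    rw [e]
    exact le_add_of_nonneg_left (by positivity)

/-- If `u = 1`, a unit vector travels to the left without decay; if `v = 1`, small coordinates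
arriving from the right are not amplified. -/
theorem not_isRecurrentOperator_twoSidedShift (hu : 0 < u) (hv : 0 < v) (h : u = 1 ∨ v = 1) :
    ¬ IsRecurrentOperator (twoSidedShift hu hv) := by
  have hW : ∀ i, twoSidedWeight u v i ≠ 0 := fun i => (twoSidedWeight_pos hu hv i).ne'
  rcases h with rfl | rfl
  · refine not_isRecurrentOperator_weightedShift_of_one_le hW 0 fun k hk => ⟨-k, by omega, ?_, ?_⟩
    · rw [add_one_iterate]
      omega
    · rw [twoSidedWeight_of_nonpos le_rfl, twoSidedWeight_of_nonpos (by omega)]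
      simp
  · refine not_isRecurrentOperator_weightedShift_of_le_one hW 0 fun k hk => ?_
    rw [add_one_iterate, twoSidedWeight_of_nonneg le_rfl, twoSidedWeight_of_nonneg (by omega)]
    exact ⟨by omega, by simp⟩

end TwoSided

theorem exists_weightedShift_of_pos (a : ℝ) (ha : 0 < a) (ha1 : a ≠ 1) (τ : ℕ) (hτ : 1 ≤ τ) :
    ∃ (lam : ℕ → ℂ) (T : lp (fun _ : ℤ => ℂ) 1 →L[ℂ] lp (fun _ : ℤ => ℂ) 1),
      (∀ n, lam n ≠ 0) ∧
      Filter.Tendsto (fun n => ‖lam n‖ / ‖lam (n + τ)‖) Filter.atTop (nhds a) ∧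
      FrequentlyUniversal (fun n => lam n • T ^ n) ∧ ¬ IsRecurrentOperator T := by
  obtain ⟨c, hc, hcτ⟩ : ∃ c : ℝ, 0 < c ∧ c ^ τ = a⁻¹ :=
    ⟨a⁻¹ ^ (τ : ℝ)⁻¹, Real.rpow_pos_of_pos (inv_pos.2 ha) _,
      Real.rpow_inv_natCast_pow (inv_nonneg.2 ha.le) (by omega)⟩
  have hc1 : c ≠ 1 := by
    rintro rfl
    rw [one_pow, eq_comm, inv_eq_one] at hcτ
    exact ha1 hcτ
  -- One of the weights is `1`, which prevents recurrence, and `c` lies strictly between the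
  -- reciprocals of the weights.
  obtain ⟨u, v, hu, hv, hcu, hcv, huv⟩ : ∃ u v : ℝ, 0 < u ∧ 0 < v ∧ c * u < 1 ∧ 1 < c * v ∧
      (u = 1 ∨ v = 1) := by
    have hsq : c * (c ^ 2)⁻¹ = c⁻¹ := by field_simp
    rcases lt_or_gt_of_ne hc1 with h | h
    · refine ⟨1, (c ^ 2)⁻¹, one_pos, by positivity, by linarith, ?_, Or.inl rfl⟩
      rw [hsq]
      exact (one_lt_inv₀ hc).2 h
    · refine ⟨(c ^ 2)⁻¹, 1, by positivity, one_pos, ?_, by linarith, Or.inr rfl⟩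
      rw [hsq]
      exact inv_lt_one_of_one_lt₀ h
  refine ⟨fun n => ((c ^ n : ℝ) : ℂ), twoSidedShift hu hv,
    fun n => Complex.ofReal_ne_zero.2 (pow_ne_zero n hc.ne'), ?_,
    frequentlyUniversal_twoSidedShift hu hv hc hcu hcv,
    not_isRecurrentOperator_twoSidedShift hu hv huv⟩
  refine tendsto_const_nhds.congr fun n => ?_
  rw [Complex.norm_real, Complex.norm_real, Real.norm_eq_abs, Real.norm_eq_abs,
    abs_of_pos (by positivity), abs_of_pos (by positivity), pow_add, hcτ]
  field_simp

/-! ### Conclusion -/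

theorem proposition1p2 (a : ℝ) (ha : 0 ≤ a) (ha1 : a ≠ 1) (τ : ℕ) (hτ : 1 ≤ τ) :
    ∃ (X : Type) (_ : NormedAddCommGroup X) (_ : NormedSpace ℂ X),
      CompleteSpace X ∧ TopologicalSpace.SeparableSpace X ∧ ¬ FiniteDimensional ℂ X ∧
      ∃ (lam : ℕ → ℂ) (T : X →L[ℂ] X),
        (∀ n : ℕ, 1 ≤ n → lam n ≠ 0) ∧
        Filter.Tendsto (fun n : ℕ => ‖lam n‖ / ‖lam (n + τ)‖) Filter.atTop (nhds a) ∧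
        FrequentlyUniversal (fun n : ℕ => lam n • T ^ n) ∧
        ¬ IsRecurrentOperator T := by
  rcases ha.eq_or_lt with rfl | ha0
  · obtain ⟨lam, T, hlam, h⟩ := exists_weightedShift_of_zero τ hτ
    exact ⟨lp (fun _ : ℕ => ℂ) 1, inferInstance, inferInstance, inferInstance,
      separableSpace_lp_one ℕ, not_finiteDimensional_lp_one ℕ, lam, T, fun n _ => hlam n, h⟩
  · obtain ⟨lam, T, hlam, h⟩ := exists_weightedShift_of_pos a ha0 ha1 τ hτ
    exact ⟨lp (fun _ : ℤ => ℂ) 1, inferInstance, inferInstance, inferInstance,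
      separableSpace_lp_one ℤ, not_finiteDimensional_lp_one ℤ, lam, T, fun n _ => hlam n, h⟩
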